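/- Let $q\in\mathbb{C}\setminus\{0\}$ with $q^m\neq 1$ for all integers $m\ge 1$, let $c\in\mathbb{C}$ with $c^2\in\mathbb{R}\setminus\{0\}$, and let $N=2n\ge 3$ be even. For $1\le i\le N$ put $i'=N+1-i$, and let $\rho_i=N/2-i$ if $i<i'$ and $\rho_i=-(N/2-i')$ if $i'<i$. For $i,j,k,l\in\{1,\dots,N\}$ define $$C^{ij}=C_{ij}=q^{-2\rho_i}\delta_{ij'},\qquad K^{ij}_{kl}=C^{ij}C_{kl},$$ $$\hat R^{ij}_{kl}=q^{2\delta_{ij}-2\delta_{ij'}}\delta_{il}\delta_{jk}+(q^2-q^{-2})\,\delta_{i<l}\,(\delta_{ik}\delta_{jl}-K^{ij}_{kl}),$$ where $\delta_{i<l}=1$ if $i<l$ and $0$ otherwise, and $$P_+=\frac{1}{q^2+q^{-2}}\Bigl(q^{-2}\,\mathrm{id}+\hat R-\frac{(q+q^{-1})(q-q^{-1})}{q^{2N}-1}K\Bigr).$$ Let $\mathrm{Cl}_q(N)$ be the FRT--Clifford algebra, that is, the unital complex algebra generated by $\gamma_1,\dots,\gamma_N$ with the relations $$\sum_{k,l=1}^N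 (P_+)^{kl}_{ij}\,\gamma_k\gamma_l=0\quad(1\le i,j\le N),\qquad \sum_{i,j=1}^N C^{ij}\gamma_i\gamma_j=c^2\,\frac{q^{2N}-1}{q^2-1}.$$ Then $\mathrm{Cl}_q(2n)$ is simple: it is nonzero and its only two-sided ideals are $\{0\}$ and $\mathrm{Cl}_q(2n)$ itself. -/

import Mathlib

/-!
Indices `1, …, N` are represented by `Fin N`; the index `i` of the literature is `i.val + 1`,
and `i' = N + 1 - i` is `Fin.rev i`.  A tensor `T^{ij}_{kl}` is the matrix entry
`T (i, j) (k, l)`.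
-/

namespace FRT

open Matrix

/-- The integer `2 ρ_i`, where `ρ_i = N/2 - i` if `i < i'`, `ρ_i = -(N/2 - i')` if `i' < i`, and
`ρ_i = 0` if `i = i'` (with `i` running through `1, …, N`). -/
def twoRho (N : ℕ) (i : Fin N) : ℤ :=
  if i < i.rev then (N : ℤ) - 2 * ((i.val : ℤ) + 1)
  else if i.rev < i then -((N : ℤ) - 2 * ((i.rev.val : ℤ) + 1))
  else 0

/-- The metric `C^{ij} = C_{ij} = q^{-2 ρ_i} δ_{i j'}`. -/
noncomputable def C (N : ℕ) (q : ℂ) (i j : Fin N) : ℂ :=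
  if i = j.rev then q ^ (-twoRho N i) else 0

/-- `K^{ij}_{kl} = C^{ij} C_{kl}`. -/
noncomputable def K (N : ℕ) (q : ℂ) : Matrix (Fin N × Fin N) (Fin N × Fin N) ℂ :=
  Matrix.of fun a b => C N q a.1 a.2 * C N q b.1 b.2

/-- The braid matrix
`R^{ij}_{kl} = q^{2δ_{ij} - 2δ_{ij'}} δ_{il} δ_{jk} + (q² - q⁻²) δ_{i<l} (δ_{ik} δ_{jl} - K^{ij}_{kl})`. -/
noncomputable def R (N : ℕ) (q : ℂ) : Matrix (Fin N × Fin N) (Fin N × Fin N) ℂ :=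
  Matrix.of fun a b =>
    (if a.1 = b.2 ∧ a.2 = b.1 then
      q ^ ((if a.1 = a.2 then (2 : ℤ) else 0) - (if a.1 = a.2.rev then (2 : ℤ) else 0)) else 0) +
    (if a.1 < b.2 then
      (q ^ 2 - (q ^ 2)⁻¹) * ((if a.1 = b.1 ∧ a.2 = b.2 then 1 else 0) - K N q a b) else 0)

/-- `P₊ = (q² + q⁻²)⁻¹ (q⁻² id + R - (q + q⁻¹)(q - q⁻¹) / (q^{2N} - 1) K)`. -/
noncomputable def Pplus (N : ℕ) (q : ℂ) : Matrix (Fin N × Fin N) (Fin N × Fin N) ℂ :=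
  (1 / (q ^ 2 + (q ^ 2)⁻¹)) •
    ((q ^ 2)⁻¹ • (1 : Matrix (Fin N × Fin N) (Fin N × Fin N) ℂ) + R N q -
      ((q + q⁻¹) * (q - q⁻¹) / (q ^ (2 * N) - 1)) • K N q)

/-- The defining relations of the FRT-Clifford algebra, on free generators `γ_1, …, γ_N`. -/
inductive CliffordRel (N : ℕ) (q c : ℂ) :
    FreeAlgebra ℂ (Fin N) → FreeAlgebra ℂ (Fin N) → Prop
  | pplus (i j : Fin N) : CliffordRel N q c
      (∑ k : Fin N, ∑ l : Fin N,
        Pplus N q (k, l) (i, j) • (FreeAlgebra.ι ℂ k * FreeAlgebra.ι ℂ l)) 0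
  | metric : CliffordRel N q c
      (∑ i : Fin N, ∑ j : Fin N, C N q i j • (FreeAlgebra.ι ℂ i * FreeAlgebra.ι ℂ j))
      (algebraMap ℂ (FreeAlgebra ℂ (Fin N)) (c ^ 2 * ((q ^ (2 * N) - 1) / (q ^ 2 - 1))))

/-- The FRT-Clifford algebra `Cl_q(N)` with parameter `c`: the unital complex algebra generated by
`γ_1, …, γ_N` with relations `P₊^{kl}_{ij} γ_k γ_l = 0` for all `i, j` and
`C^{ij} γ_i γ_j = c² (q^{2N} - 1) / (q² - 1)`. -/
abbrev Clifford (N : ℕ) (q c : ℂ) : Type :=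
  RingQuot (CliffordRel N q c)

end FRT

/-! The proof is an induction in steps of two: `Cl_q(N+2)` is a nonzero quotient of the 2 × 2
matrices over `Cl_q(N)`, hence simple if `Cl_q(N)` is. The outer generators u, v of `Cl_q(N+2)`
square to zero and uv + vu = κ with κ = (q² + 1)c²q^N ≠ 0, so they span a copy of M₂(ℂ) with
idempotent e = κ⁻¹uv. The inner generators commute with u and v only up to factors -q² or its
inverse. Since u and v are off-diagonal with respect to e, multiplying the inner generators by 1 +
(a - 1)e with a = -q⁻² makes them commute with u and v, and the results satisfy the relations for N
(`IsCliffordFamily.untwist`). By the universal property they give a map from `Cl_q(N)`, which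
extends along the matrix units to M₂(`Cl_q(N)`) → `Cl_q(N+2)` (`exists_matrixAlgHom`). The twist is
invertible, so this map is surjective. The target is nonzero because the construction reverses:
`IsCliffordFamily.extend_twist` represents `Cl_q(N+2)` in M₂(`Cl_q(N)`). -/

namespace FRT

/-- The weights `q^{-2ρ_i}` of the metric. -/
noncomputable def weight (N : ℕ) (q : ℂ) (i : Fin N) : ℂ := q ^ (-twoRho N i)

/-- The partial sums `∑_{k < j} C^{k k'} g_k g_{k'}` of the metric. -/
noncomputable def partialMetric {A : Type*} [Ring A] [Algebra ℂ A] (N : ℕ) (q : ℂ)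
    (g : Fin N → A) (j : Fin N) : A :=
  ∑ k : Fin N, if k < j then weight N q k • (g k * g k.rev) else 0

/-- The defining relations of the FRT-Clifford algebra for `N` even, written out case by case. -/
structure IsCliffordFamily {A : Type*} [Ring A] [Algebra ℂ A] (N : ℕ) (q c : ℂ)
    (g : Fin N → A) : Prop where
  sq : ∀ i, g i * g i = 0
  anti : ∀ i j, i < j → i ≠ j.rev → g j * g i = -q ^ 2 • (g i * g j)
  up : ∀ i, i < i.rev → q ^ 2 • (g i * g i.rev) + (q ^ 2)⁻¹ • (g i.rev * g i) =
    weight N q i • ((c ^ 2 * (1 + (q ^ 2)⁻¹)) • (1 : A) +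
      (q ^ 2 - (q ^ 2)⁻¹) • partialMetric N q g i.rev)
  down : ∀ i, i.rev < i → (q ^ 2)⁻¹ • (g i * g i.rev) + (q ^ 2)⁻¹ • (g i.rev * g i) =
    weight N q i • ((c ^ 2 * (1 + (q ^ 2)⁻¹)) • (1 : A) +
      (q ^ 2 - (q ^ 2)⁻¹) • partialMetric N q g i.rev)
  metric : ∑ k, weight N q k • (g k * g k.rev) =
    (c ^ 2 * ((q ^ (2 * N) - 1) / (q ^ 2 - 1))) • (1 : A)

/-! ### Contractions of C, R and P₊ with a tensor -/

section Generators

variable {A : Type*} [Ring A] [Algebra ℂ A]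

lemma sum_C_smul (N : ℕ) (q : ℂ) (Y : Fin N → Fin N → A) (k : Fin N) :
    ∑ l, C N q k l • Y k l = weight N q k • Y k k.rev := by
  rw [Finset.sum_eq_single k.rev]
  · simp [C, weight]
  · intro l _ hl
    have : k ≠ l.rev := fun h => hl (by rw [h, Fin.rev_rev])
    simp [C, this]
  · simp

lemma sum_R_smul (N : ℕ) (q : ℂ) (Y : Fin N → Fin N → A) (i j : Fin N) :
    ∑ k, ∑ l, R N q (k, l) (i, j) • Y k l =
      q ^ ((if i = j then (2 : ℤ) else 0) - (if i = j.rev then (2 : ℤ) else 0)) • Y j i +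
      (q ^ 2 - (q ^ 2)⁻¹) • ((if i < j then Y i j else 0) -
        C N q i j • ∑ k, if k < j then weight N q k • Y k k.rev else 0) := by
  have h1 : ∑ k, ∑ l, (if k = j ∧ l = i then
      q ^ ((if k = l then (2 : ℤ) else 0) - (if k = l.rev then (2 : ℤ) else 0)) else 0) • Y k l =
      q ^ ((if i = j then (2 : ℤ) else 0) - (if i = j.rev then (2 : ℤ) else 0)) • Y j i := by
    rw [Finset.sum_eq_single j, Finset.sum_eq_single i]
    · have : (j = i.rev) = (i = j.rev) := propext ⟨fun h => by rw [h, Fin.rev_rev],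
        fun h => by rw [h, Fin.rev_rev]⟩
      simp [eq_comm (a := j) (b := i), this]
    · intro l _ hl; simp [hl]
    · simp
    · intro k _ hk; simp [hk]
    · simp
  have h2 : ∑ k, ∑ l, (if k < j then (if k = i ∧ l = j then (1 : ℂ) else 0) else 0) • Y k l =
      if i < j then Y i j else 0 := by
    rw [Finset.sum_eq_single i, Finset.sum_eq_single j]
    · split_ifs <;> simp_all
    · intro l _ hl; simp [hl]
    · simp
    · intro k _ hk; simp [hk]
    · simp
  have h3 : ∑ k, ∑ l, (if k < j then C N q k l else 0) • Y k l =
      ∑ k, if k < j then weight N q k • Y k k.rev else 0 := by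
    refine Finset.sum_congr rfl fun k _ => ?_
    split_ifs
    · exact sum_C_smul N q Y k
    · simp
  rw [← h1, ← h2, ← h3]
  simp only [Finset.smul_sum, ← Finset.sum_sub_distrib, ← Finset.sum_add_distrib]
  refine Finset.sum_congr rfl fun k _ => Finset.sum_congr rfl fun l _ => ?_
  simp only [R, K, Matrix.of_apply]
  split_ifs <;> module

/-- The `P₊`-relation with the projector written out. -/
lemma sum_Pplus_smul (N : ℕ) (q : ℂ) (Y : Fin N → Fin N → A) (i j : Fin N) :
    ∑ k, ∑ l, Pplus N q (k, l) (i, j) • Y k l =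
      (1 / (q ^ 2 + (q ^ 2)⁻¹)) • ((q ^ 2)⁻¹ • Y i j +
      (q ^ ((if i = j then (2 : ℤ) else 0) - (if i = j.rev then (2 : ℤ) else 0)) • Y j i +
      (q ^ 2 - (q ^ 2)⁻¹) • ((if i < j then Y i j else 0) -
        C N q i j • ∑ k, if k < j then weight N q k • Y k k.rev else 0)) -
      (((q + q⁻¹) * (q - q⁻¹) / (q ^ (2 * N) - 1)) * C N q i j) •
        ∑ k, ∑ l, C N q k l • Y k l) := by
  have h1 : ∑ k, ∑ l, (1 : Matrix (Fin N × Fin N) (Fin N × Fin N) ℂ) (k, l) (i, j) • Y k l =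
      Y i j := by
    rw [Finset.sum_eq_single i, Finset.sum_eq_single j]
    · simp
    · intro l _ hl; simp [hl]
    · simp
    · intro k _ hk; simp [hk]
    · simp
  rw [← sum_R_smul]
  conv_rhs => rw [← h1]
  simp only [Finset.smul_sum, ← Finset.sum_sub_distrib, ← Finset.sum_add_distrib]
  refine Finset.sum_congr rfl fun k _ => Finset.sum_congr rfl fun l _ => ?_
  simp only [Pplus, K, Matrix.smul_apply, Matrix.sub_apply, Matrix.add_apply, Matrix.of_apply,
    smul_eq_mul]
  module

end Generators

/-! ### The relations in explicit form -/

section Presentation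

variable {A : Type*} [Ring A] [Algebra ℂ A]

/-- For even `N`, the relations of the FRT-Clifford algebra amount to `IsCliffordFamily`. -/
lemma isCliffordFamily_iff {N : ℕ} {q c : ℂ} (hN : ∀ i : Fin N, i ≠ i.rev) (hq0 : q ≠ 0)
    (hq2 : q ^ 2 - 1 ≠ 0) (hq4 : q ^ 4 + 1 ≠ 0) (hqN : 0 < N → q ^ (2 * N) - 1 ≠ 0)
    (g : Fin N → A) :
    IsCliffordFamily N q c g ↔
      (∀ i j, ∑ k, ∑ l, Pplus N q (k, l) (i, j) • (g k * g l) = 0) ∧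
      ∑ i, ∑ j, C N q i j • (g i * g j) =
        (c ^ 2 * ((q ^ (2 * N) - 1) / (q ^ 2 - 1))) • (1 : A) := by
  have hC : ∑ i, ∑ j, C N q i j • (g i * g j) = ∑ k, weight N q k • (g k * g k.rev) :=
    Finset.sum_congr rfl fun k _ => sum_C_smul N q (fun i j => g i * g j) k
  rw [hC]
  have hq4' : q ^ 2 + (q ^ 2)⁻¹ ≠ 0 := by
    intro h
    apply hq4
    field_simp at h
    linear_combination h
  have key : ∑ k, weight N q k • (g k * g k.rev) =
      (c ^ 2 * ((q ^ (2 * N) - 1) / (q ^ 2 - 1))) • (1 : A) → ∀ i j,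
      (∑ k, ∑ l, Pplus N q (k, l) (i, j) • (g k * g l) = 0 ↔
        (q ^ 2)⁻¹ • (g i * g j) +
        q ^ ((if i = j then (2 : ℤ) else 0) - (if i = j.rev then (2 : ℤ) else 0)) • (g j * g i) +
        (q ^ 2 - (q ^ 2)⁻¹) • (if i < j then g i * g j else 0) =
        C N q i j • ((c ^ 2 * (1 + (q ^ 2)⁻¹)) • (1 : A) +
          (q ^ 2 - (q ^ 2)⁻¹) • partialMetric N q g j)) := by
    intro hm i j
    have hqN' := hqN i.pos
    rw [sum_Pplus_smul N q (fun i j => g i * g j), hC, hm, smul_eq_zero,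
      or_iff_right (one_div_ne_zero hq4'), ← sub_eq_zero (b := C N q i j • _)]
    -- The metric relation turns the K-term into a scalar: (q² - q⁻²)/(q² - 1) = 1 + q⁻².
    have h1 : (((q + q⁻¹) * (q - q⁻¹) / (q ^ (2 * N) - 1)) * C N q i j) •
        (c ^ 2 * ((q ^ (2 * N) - 1) / (q ^ 2 - 1))) • (1 : A) =
        (C N q i j * (c ^ 2 * (1 + (q ^ 2)⁻¹))) • (1 : A) := by
      rw [smul_smul]
      congr 1
      field_simp
    rw [h1]
    refine Eq.congr_left ?_
    rw [partialMetric]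
    module
  constructor
  · intro h
    refine ⟨fun i j => (key h.metric i j).2 ?_, h.metric⟩
    rcases eq_or_ne i j.rev with hij | hij
    · obtain rfl : j = i.rev := by rw [hij, Fin.rev_rev]
      rcases lt_or_gt_of_ne (hN i) with hlt | hlt
      · have := h.up i hlt
        simp only [C, hN i, hlt, Fin.rev_rev, if_true, if_false]
        rw [weight] at this
        rw [← this, zero_sub, zpow_neg, zpow_ofNat]
        module
      · have := h.down i hlt
        simp only [C, hN i, hlt.not_gt, Fin.rev_rev, if_true, if_false]
        rw [weight] at this
        rw [← this, zero_sub, zpow_neg, zpow_ofNat]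
        module
    · simp only [C, hij, if_false, sub_zero, zero_smul]
      rcases lt_trichotomy i j with hlt | rfl | hlt
      · simp only [hlt, hlt.ne, if_true, if_false, zpow_zero, h.anti i j hlt hij]
        module
      · simp [h.sq]
      -- For i ≠ j', the relations at (i, j) and (j, i) are proportional, so `anti` covers both.
      · have := h.anti j i hlt (fun h => hij (by rw [h, Fin.rev_rev]))
        simp only [hlt.not_gt, hlt.ne', if_false, zpow_zero, this]
        match_scalars
        field_simp
        ring
  · rintro ⟨h, hm⟩
    have h' := fun i j => (key hm i j).1 (h i j)
    refine ⟨fun i => ?_, fun i j hlt hij => ?_, fun i hlt => ?_, fun i hlt => ?_, hm⟩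
    · have := h' i i
      simp only [C, hN i, if_true, if_false, sub_zero, zero_smul, lt_irrefl, smul_zero,
        add_zero, zpow_ofNat] at this
      rw [← add_smul, smul_eq_zero, add_comm, or_iff_right hq4'] at this
      exact this
    · have := h' i j
      simp only [C, hij, hlt, hlt.ne, if_true, if_false, sub_zero, zero_smul, zpow_zero] at this
      linear_combination (norm := module) this
    · have := h' i i.rev
      simp only [C, hN i, hlt, Fin.rev_rev, if_true, if_false, zero_sub, zpow_neg,
        zpow_ofNat] at this
      rw [weight, zpow_neg, ← this]
      module
    · have := h' i i.rev
      simp only [C, hN i, hlt.not_gt, Fin.rev_rev, if_true, if_false, zero_sub, zpow_neg,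
        zpow_ofNat, smul_zero, add_zero] at this
      rw [weight, zpow_neg, ← this]

end Presentation

/-! ### Generators and the universal property -/

/-- The generators `γ_i` of the FRT-Clifford algebra. -/
noncomputable def gen (N : ℕ) (q c : ℂ) (i : Fin N) : Clifford N q c :=
  RingQuot.mkAlgHom ℂ (CliffordRel N q c) (FreeAlgebra.ι ℂ i)

lemma gen_pplus (N : ℕ) (q c : ℂ) (i j : Fin N) :
    ∑ k, ∑ l, Pplus N q (k, l) (i, j) • (gen N q c k * gen N q c l) = 0 := by
  simpa [gen] using RingQuot.mkAlgHom_rel ℂ (CliffordRel.pplus (N := N) (q := q) (c := c) i j)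

lemma gen_metric (N : ℕ) (q c : ℂ) :
    ∑ i, ∑ j, C N q i j • (gen N q c i * gen N q c j) =
      (c ^ 2 * ((q ^ (2 * N) - 1) / (q ^ 2 - 1))) • (1 : Clifford N q c) := by
  have := RingQuot.mkAlgHom_rel ℂ (CliffordRel.metric (N := N) (q := q) (c := c))
  rw [AlgHom.commutes, Algebra.algebraMap_eq_smul_one] at this
  simp only [map_sum, map_smul, map_mul] at this
  exact this

lemma adjoin_gen (N : ℕ) (q c : ℂ) : Algebra.adjoin ℂ (Set.range (gen N q c)) = ⊤ := by
  have h : Set.range (gen N q c) =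
      RingQuot.mkAlgHom ℂ (CliffordRel N q c) '' Set.range (FreeAlgebra.ι ℂ) := by
    rw [← Set.range_comp]; rfl
  rw [h, ← AlgHom.map_adjoin, FreeAlgebra.adjoin_range_ι, Algebra.map_top, AlgHom.range_eq_top]
  exact RingQuot.mkAlgHom_surjective ℂ _

/-- The universal property of the FRT-Clifford algebra. -/
lemma exists_lift {A : Type*} [Ring A] [Algebra ℂ A] {N : ℕ} {q c : ℂ} {g : Fin N → A}
    (hP : ∀ i j, ∑ k, ∑ l, Pplus N q (k, l) (i, j) • (g k * g l) = 0)
    (hm : ∑ i, ∑ j, C N q i j • (g i * g j) =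
      (c ^ 2 * ((q ^ (2 * N) - 1) / (q ^ 2 - 1))) • (1 : A)) :
    ∃ φ : Clifford N q c →ₐ[ℂ] A, ∀ i, φ (gen N q c i) = g i := by
  refine ⟨RingQuot.liftAlgHom ℂ ⟨FreeAlgebra.lift ℂ g, ?_⟩, fun i => ?_⟩
  · rintro _ _ (⟨i, j⟩ | _)
    · simpa using hP i j
    · rw [AlgHom.commutes, Algebra.algebraMap_eq_smul_one]
      simpa using hm
  · simp [gen]

/-! ### Outer and inner indices -/

section Indices

/-- The inclusion of `Fin N` as the inner indices of `Fin (N + 2)`. -/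
abbrev inner {N : ℕ} (i : Fin N) : Fin (N + 2) := i.succ.castSucc

lemma rev_inner {N : ℕ} (i : Fin N) : (inner i).rev = inner i.rev := by
  rw [Fin.rev_castSucc, Fin.rev_succ, Fin.succ_castSucc]

lemma inner_lt_inner {N : ℕ} {i j : Fin N} : inner i < inner j ↔ i < j := by
  simp

lemma inner_injective {N : ℕ} : Function.Injective (inner : Fin N → Fin (N + 2)) :=
  fun i j h => by simpa using h

lemma zero_lt_inner {N : ℕ} (i : Fin N) : 0 < inner i := by
  simp [Fin.lt_def]

lemma inner_lt_last {N : ℕ} (i : Fin N) : inner i < Fin.last (N + 1) := Fin.castSucc_lt_last _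

lemma outer_inner_cases {N : ℕ} {p : Fin (N + 2) → Prop} (h0 : p 0) (hl : p (Fin.last (N + 1)))
    (hi : ∀ i : Fin N, p (inner i)) (i : Fin (N + 2)) : p i := by
  induction i using Fin.lastCases with
  | last => exact hl
  | cast i =>
    induction i using Fin.cases with
    | zero => exact h0
    | succ i => exact hi i

lemma sum_outer_inner {M : Type*} [AddCommMonoid M] {N : ℕ} (f : Fin (N + 2) → M) :
    ∑ i, f i = f 0 + ∑ i : Fin N, f (inner i) + f (Fin.last (N + 1)) := by
  rw [Fin.sum_univ_castSucc, Fin.sum_univ_succ]; rfl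

lemma weight_inner {N : ℕ} (q : ℂ) (i : Fin N) : weight (N + 2) q (inner i) = weight N q i := by
  have h : twoRho (N + 2) (inner i) = twoRho N i := by
    simp only [twoRho, rev_inner, inner_lt_inner]
    split_ifs <;> simp <;> ring
  rw [weight, weight, h]

lemma weight_zero (N : ℕ) (q : ℂ) : weight (N + 2) q 0 = (q ^ N)⁻¹ := by
  have h : twoRho (N + 2) 0 = N := by
    simp [twoRho]
  rw [weight, h, zpow_neg, zpow_natCast]

lemma weight_last (N : ℕ) (q : ℂ) : weight (N + 2) q (Fin.last (N + 1)) = q ^ N := by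
  have h : twoRho (N + 2) (Fin.last (N + 1)) = -N := by
    simp [twoRho]
  rw [weight, h, neg_neg, zpow_natCast]

/-- The family with outer members `u`, `v` and inner members `g i`. -/
def extend {A : Type*} {N : ℕ} (u v : A) (g : Fin N → A) : Fin (N + 2) → A :=
  Fin.snoc (α := fun _ => A) (Fin.cons (α := fun _ => A) u g) v

@[simp] lemma extend_zero {A : Type*} {N : ℕ} (u v : A) (g : Fin N → A) : extend u v g 0 = u := by
  rw [extend, ← Fin.castSucc_zero, Fin.snoc_castSucc, Fin.cons_zero]

@[simp] lemma extend_last {A : Type*} {N : ℕ} (u v : A) (g : Fin N → A) :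
    extend u v g (Fin.last (N + 1)) = v := by
  rw [extend, Fin.snoc_last]

@[simp] lemma extend_inner {A : Type*} {N : ℕ} (u v : A) (g : Fin N → A) (i : Fin N) :
    extend u v g (inner i) = g i := by
  rw [extend, inner, Fin.snoc_castSucc, Fin.cons_succ]

end Indices

/-! ### Fermion pairs and twists -/

section Twist

variable {A : Type*} [Ring A] [Algebra ℂ A]

/-- Two square-zero elements which generate a copy of the `2 × 2` matrices. -/
structure IsFermionPair (κ : ℂ) (u v : A) : Prop where
  sq_left : u * u = 0
  sq_right : v * v = 0
  add : u * v + v * u = κ • (1 : A)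

/-- The idempotent `κ⁻¹ u v` of a fermion pair. -/
noncomputable def idem (κ : ℂ) (u v : A) : A := κ⁻¹ • (u * v)

/-- The element `a e + (1 - e)`. -/
noncomputable def twist (e : A) (a : ℂ) : A := 1 + (a - 1) • e

lemma twist_mul_twist {e : A} (he : e * e = e) (a b : ℂ) :
    twist e a * twist e b = twist e (a * b) := by
  simp only [twist, mul_add, add_mul, smul_mul_assoc, mul_smul_comm, he, mul_one, one_mul]
  module

@[simp] lemma twist_one (e : A) : twist e 1 = 1 := by simp [twist]

lemma commute_twist {e x : A} (h : Commute e x) (a : ℂ) : Commute (twist e a) x :=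
  (Commute.one_left x).add_left (h.smul_left _)

namespace IsFermionPair

variable {κ : ℂ} {u v : A}

lemma right_mul_left (h : IsFermionPair κ u v) : v * u = κ • (1 : A) - u * v := by
  rw [← h.add]; abel

lemma left_mul_right (hκ : κ ≠ 0) : u * v = κ • idem κ u v := by
  rw [idem, smul_smul, mul_inv_cancel₀ hκ, one_smul]

lemma left_right_left (h : IsFermionPair κ u v) : u * v * u = κ • u := by
  rw [mul_assoc, h.right_mul_left, mul_sub, ← mul_assoc, h.sq_left]; simp

lemma right_left_right (h : IsFermionPair κ u v) : v * (u * v) = κ • v := by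
  rw [← mul_assoc, h.right_mul_left, sub_mul, mul_assoc, h.sq_right]; simp

/-- With e the idempotent, this and the next three lemmas say u = e u (1 - e) and v = (1 - e) v e. A
twist therefore scales u from the left only and v from the right only. -/
lemma idem_mul_left (h : IsFermionPair κ u v) (hκ : κ ≠ 0) : idem κ u v * u = u := by
  rw [idem, smul_mul_assoc, h.left_right_left, smul_smul, inv_mul_cancel₀ hκ, one_smul]

lemma right_mul_idem (h : IsFermionPair κ u v) (hκ : κ ≠ 0) : v * idem κ u v = v := by
  rw [idem, mul_smul_comm, h.right_left_right, smul_smul, inv_mul_cancel₀ hκ, one_smul]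

lemma left_mul_idem (h : IsFermionPair κ u v) : u * idem κ u v = 0 := by
  rw [idem, mul_smul_comm, ← mul_assoc, h.sq_left]; simp

lemma idem_mul_right (h : IsFermionPair κ u v) : idem κ u v * v = 0 := by
  rw [idem, smul_mul_assoc, mul_assoc, h.sq_right]; simp

lemma idem_mul_idem (h : IsFermionPair κ u v) (hκ : κ ≠ 0) :
    idem κ u v * idem κ u v = idem κ u v := by
  nth_rewrite 1 [idem]
  rw [smul_mul_assoc, mul_assoc, h.right_mul_idem hκ, idem]

lemma twist_mul_left (h : IsFermionPair κ u v) (hκ : κ ≠ 0) (a : ℂ) :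
    twist (idem κ u v) a * u = a • u := by
  rw [twist, add_mul, smul_mul_assoc, h.idem_mul_left hκ, one_mul]; module

lemma left_mul_twist (h : IsFermionPair κ u v) (a : ℂ) : u * twist (idem κ u v) a = u := by
  rw [twist, mul_add, mul_smul_comm, h.left_mul_idem]; simp

lemma twist_mul_right (h : IsFermionPair κ u v) (a : ℂ) : twist (idem κ u v) a * v = v := by
  rw [twist, add_mul, smul_mul_assoc, h.idem_mul_right]; simp

lemma right_mul_twist (h : IsFermionPair κ u v) (hκ : κ ≠ 0) (a : ℂ) :
    v * twist (idem κ u v) a = a • v := by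
  rw [twist, mul_add, mul_smul_comm, h.right_mul_idem hκ, mul_one]; module

end IsFermionPair

lemma commute_idem {κ : ℂ} {u v x : A} (hu : Commute u x) (hv : Commute v x) :
    Commute (idem κ u v) x := (hu.mul_left hv).smul_left _

lemma twist_mul_mul_twist_mul {e : A} (he : e * e = e) (a : ℂ) {x : A} (hx : Commute e x) (y : A) :
    twist e a * x * (twist e a * y) = twist e (a * a) * (x * y) := by
  rw [mul_assoc, ← mul_assoc x, ← (commute_twist hx a).eq, ← twist_mul_twist he]
  simp only [mul_assoc]

lemma partialMetric_twist_mul {N : ℕ} (q : ℂ) {e : A} (he : e * e = e) (a : ℂ) (g : Fin N → A)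
    (hg : ∀ i, Commute e (g i)) (j : Fin N) :
    partialMetric N q (fun i => twist e a * g i) j =
      twist e (a * a) * partialMetric N q g j := by
  simp only [partialMetric, Finset.mul_sum]
  refine Finset.sum_congr rfl fun k _ => ?_
  rw [twist_mul_mul_twist_mul he a (hg k)]
  split_ifs <;> simp

lemma partialMetric_inner {N : ℕ} (q : ℂ) (g : Fin (N + 2) → A) (j : Fin N) :
    partialMetric (N + 2) q g (inner j) =
      (q ^ N)⁻¹ • (g 0 * g (Fin.last (N + 1))) + partialMetric N q (fun i => g (inner i)) j := by
  simp only [partialMetric]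
  rw [sum_outer_inner]
  simp only [zero_lt_inner, (inner_lt_last j).not_gt, inner_lt_inner, weight_zero, weight_inner,
    rev_inner, if_true, if_false, add_zero, Fin.rev_zero]

lemma partialMetric_last {N : ℕ} (q : ℂ) (g : Fin (N + 2) → A) :
    partialMetric (N + 2) q g (Fin.last (N + 1)) =
      (q ^ N)⁻¹ • (g 0 * g (Fin.last (N + 1))) +
        ∑ i : Fin N, weight N q i • (g (inner i) * g (inner i.rev)) := by
  simp only [partialMetric]
  rw [sum_outer_inner]
  simp only [inner_lt_last, weight_zero, weight_inner, Fin.last_pos, lt_irrefl,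
    rev_inner, if_true, if_false, add_zero, Fin.rev_zero]

lemma partialMetric_zero {N : ℕ} (q : ℂ) (g : Fin (N + 2) → A) :
    partialMetric (N + 2) q g 0 = 0 := by
  simp [partialMetric]

lemma sum_metric_eq {N : ℕ} (q : ℂ) (g : Fin (N + 2) → A) :
    ∑ k, weight (N + 2) q k • (g k * g k.rev) =
      (q ^ N)⁻¹ • (g 0 * g (Fin.last (N + 1))) +
        ∑ i : Fin N, weight N q i • (g (inner i) * g (inner i.rev)) +
        q ^ N • (g (Fin.last (N + 1)) * g 0) := by
  rw [sum_outer_inner]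
  simp only [weight_zero, weight_inner, weight_last, rev_inner, Fin.rev_zero, Fin.rev_last]

/-- The scalar `γ_1 γ_{N+2} + γ_{N+2} γ_1`. -/
noncomputable def pairScalar (N : ℕ) (q c : ℂ) : ℂ := (q ^ 2 + 1) * c ^ 2 * q ^ N

end Twist

/-! ### Passing between N and N + 2 -/

section Recursion

variable {A : Type*} [Ring A] [Algebra ℂ A]

/-- The outer fermion pair turns twisted copies of a family for `N` into a family for `N + 2`. -/
lemma IsCliffordFamily.extend_twist {N : ℕ} {q c : ℂ} (hq0 : q ≠ 0) (hq2 : q ^ 2 - 1 ≠ 0)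
    (hκ : pairScalar N q c ≠ 0) {u v : A} (huv : IsFermionPair (pairScalar N q c) u v)
    {g : Fin N → A} (hg : IsCliffordFamily N q c g) (hu : ∀ i, Commute u (g i))
    (hv : ∀ i, Commute v (g i)) :
    IsCliffordFamily (N + 2) q c
      (extend u v fun i => twist (idem (pairScalar N q c) u v) (-q ^ 2) * g i) := by
  set κ := pairScalar N q c with hκdef
  set e := idem κ u v with hedef
  have he : e * e = e := huv.idem_mul_idem hκ
  have hc : ∀ i, Commute e (g i) := fun i => commute_idem (hu i) (hv i)
  have hprod : ∀ i j, twist e (-q ^ 2) * g i * (twist e (-q ^ 2) * g j) =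
      twist e (q ^ 4) * (g i * g j) := fun i j => by
    rw [twist_mul_mul_twist_mul he _ (hc i)]
    congr 2
    ring
  have hUV : u * v = κ • e := IsFermionPair.left_mul_right hκ
  have hVU : v * u = κ • (1 : A) - κ • e := by rw [huv.right_mul_left, hUV]
  -- The new outer term (q² + 1)c² e makes up exactly for twisting the constant term of the
  -- relations, because (q² - q⁻²)(q² + 1) = (1 + q⁻²)(q⁴ - 1). This is where the parameter -q²,
  -- with square q⁴, is needed.
  have hP : ∀ j, partialMetric (N + 2) q
      (extend u v fun i => twist e (-q ^ 2) * g i) (inner j) =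
      ((q ^ 2 + 1) * c ^ 2) • e + twist e (q ^ 4) * partialMetric N q g j := by
    intro j
    rw [partialMetric_inner]
    simp only [extend_zero, extend_last, extend_inner]
    rw [partialMetric_twist_mul q he _ g hc, hUV, smul_smul]
    congr 2
    · rw [hκdef, pairScalar]; field_simp
    · congr 1; ring
  have hM : ∑ i : Fin N, weight N q i •
      (twist e (-q ^ 2) * g i * (twist e (-q ^ 2) * g i.rev)) =
      (c ^ 2 * ((q ^ (2 * N) - 1) / (q ^ 2 - 1))) • twist e (q ^ 4) := by
    have : twist e (q ^ 4) * ∑ i, weight N q i • (g i * g i.rev) =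
        (c ^ 2 * ((q ^ (2 * N) - 1) / (q ^ 2 - 1))) • twist e (q ^ 4) := by
      rw [hg.metric, mul_smul_comm, mul_one]
    simpa only [hprod, Finset.mul_sum, mul_smul_comm] using this
  refine ⟨?_, ?_, ?_, ?_, ?_⟩
  · refine outer_inner_cases ?_ ?_ fun i => ?_
    · simpa using huv.sq_left
    · simpa using huv.sq_right
    · rw [extend_inner, hprod, hg.sq, mul_zero]
  · refine outer_inner_cases (outer_inner_cases ?_ ?_ fun j => ?_)
      (outer_inner_cases ?_ ?_ fun j => ?_)
      fun i => outer_inner_cases ?_ ?_ fun j => ?_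
    · simp
    · simp
    · intro _ _
      simp only [extend_zero, extend_inner]
      rw [mul_assoc, ← (hu j).eq, ← mul_assoc, ← mul_assoc, huv.twist_mul_left hκ,
        huv.left_mul_twist, smul_mul_assoc]
    · simp
    · simp
    · intro h; exact absurd h (inner_lt_last j).not_gt
    · intro h; exact absurd h (zero_lt_inner i).not_gt
    · intro _ _
      simp only [extend_last, extend_inner]
      rw [mul_assoc, ← (hv i).eq, ← mul_assoc, ← mul_assoc, huv.right_mul_twist hκ,
        huv.twist_mul_right, smul_mul_assoc]
    · intro h h'
      simp only [extend_inner, hprod]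
      rw [hg.anti i j (inner_lt_inner.1 h) (fun h => h' (by rw [rev_inner, h])), mul_smul_comm]
  · refine outer_inner_cases ?_ ?_ fun i => ?_
    · intro _
      simp only [Fin.rev_zero, partialMetric_last, extend_zero, extend_last, extend_inner, hM,
        hUV, hVU, weight_zero]
      simp only [twist]
      rw [hκdef, pairScalar]
      match_scalars <;> field_simp <;> ring
    · intro h; simp at h
    · intro h
      rw [rev_inner, inner_lt_inner] at h
      have := congrArg (twist e (q ^ 4) * ·) (hg.up i h)
      simp only [mul_add, mul_smul_comm, mul_one] at this
      simp only [rev_inner, extend_inner, hprod, hP, weight_inner]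
      rw [this]
      simp only [twist]
      match_scalars <;> field_simp
  · refine outer_inner_cases ?_ ?_ fun i => ?_
    · intro h; simp at h
    · intro _
      simp only [Fin.rev_last, partialMetric_zero, extend_zero, extend_last, hUV, hVU, weight_last]
      rw [hκdef, pairScalar]
      match_scalars <;> field_simp
      ring
    · intro h
      rw [rev_inner, inner_lt_inner] at h
      have := congrArg (twist e (q ^ 4) * ·) (hg.down i h)
      simp only [mul_add, mul_smul_comm, mul_one] at this
      simp only [rev_inner, extend_inner, hprod, hP, weight_inner]
      rw [this]
      simp only [twist]
      match_scalars <;> field_simp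
  · rw [sum_metric_eq]
    simp only [extend_zero, extend_last, extend_inner, hM, hUV, hVU]
    simp only [twist]
    rw [hκdef, pairScalar]
    match_scalars <;> field_simp <;> ring

variable {N : ℕ} {q c : ℂ} {γ : Fin (N + 2) → A}

/-- The outer members of a family form a fermion pair. -/
lemma IsCliffordFamily.isFermionPair (hq0 : q ≠ 0) (h : IsCliffordFamily (N + 2) q c γ) :
    IsFermionPair (pairScalar N q c) (γ 0) (γ (Fin.last (N + 1))) := by
  refine ⟨h.sq _, h.sq _, ?_⟩
  -- At the last index the partial metric sum is empty, so only the scalar term remains.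
  have := h.down (Fin.last (N + 1)) (by rw [Fin.rev_last]; exact Fin.last_pos)
  rw [Fin.rev_last, partialMetric_zero, weight_last] at this
  have h2 := congrArg (q ^ 2 • ·) this
  simp only [smul_add, smul_smul, smul_zero, add_zero] at h2
  rw [mul_inv_cancel₀ (pow_ne_zero 2 hq0), one_smul, one_smul, add_comm] at h2
  rw [h2, pairScalar]
  congr 1
  field_simp

lemma IsCliffordFamily.inner_mul_zero (h : IsCliffordFamily (N + 2) q c γ) (i : Fin N) :
    γ (inner i) * γ 0 = -q ^ 2 • (γ 0 * γ (inner i)) :=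
  h.anti _ _ (zero_lt_inner i) fun h => by
    rw [rev_inner] at h; exact (zero_lt_inner i.rev).ne h

lemma IsCliffordFamily.last_mul_inner (h : IsCliffordFamily (N + 2) q c γ) (i : Fin N) :
    γ (Fin.last (N + 1)) * γ (inner i) = -q ^ 2 • (γ (inner i) * γ (Fin.last (N + 1))) :=
  h.anti _ _ (inner_lt_last i) fun h => by
    rw [Fin.rev_last] at h; exact (zero_lt_inner i).ne' h

/-- Moving γ_i across u and across v gives the same factor -q² in opposite directions, and the two
cancel in uv. -/
lemma IsCliffordFamily.commute_idem_inner (h : IsCliffordFamily (N + 2) q c γ)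
    (κ : ℂ) (i : Fin N) :
    Commute (idem κ (γ 0) (γ (Fin.last (N + 1)))) (γ (inner i)) := by
  refine Commute.smul_left ?_ _
  rw [commute_iff_eq, mul_assoc, h.last_mul_inner, mul_smul_comm, ← mul_assoc, ← mul_assoc,
    h.inner_mul_zero, smul_mul_assoc]

/-- The inner members of a family, with the twist by the outer pair removed. -/
noncomputable def untwist (q c : ℂ) (γ : Fin (N + 2) → A) (i : Fin N) : A :=
  twist (idem (pairScalar N q c) (γ 0) (γ (Fin.last (N + 1)))) (-(q ^ 2)⁻¹) * γ (inner i)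

/-- The twist acts trivially to the right of u and by -q⁻² to its left, which cancels the factor -q²
from moving u past γ_i. -/
lemma IsCliffordFamily.commute_zero_untwist (h : IsCliffordFamily (N + 2) q c γ) (hq0 : q ≠ 0)
    (hκ : pairScalar N q c ≠ 0) (i : Fin N) : Commute (γ 0) (untwist q c γ i) := by
  have huv := h.isFermionPair hq0
  rw [commute_iff_eq, untwist, ← mul_assoc, huv.left_mul_twist, mul_assoc, h.inner_mul_zero,
    mul_smul_comm, ← mul_assoc, huv.twist_mul_left hκ, smul_mul_assoc, smul_smul]
  rw [neg_mul_neg, mul_inv_cancel₀ (pow_ne_zero 2 hq0), one_smul]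

lemma IsCliffordFamily.commute_last_untwist (h : IsCliffordFamily (N + 2) q c γ) (hq0 : q ≠ 0)
    (hκ : pairScalar N q c ≠ 0) (i : Fin N) :
    Commute (γ (Fin.last (N + 1))) (untwist q c γ i) := by
  have huv := h.isFermionPair hq0
  rw [commute_iff_eq, untwist, ← mul_assoc, huv.right_mul_twist hκ,
    (commute_twist (h.commute_idem_inner _ i) _).eq, mul_assoc, huv.twist_mul_right,
    smul_mul_assoc, h.last_mul_inner, smul_smul]
  rw [neg_mul_neg, inv_mul_cancel₀ (pow_ne_zero 2 hq0), one_smul]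

lemma IsCliffordFamily.twist_mul_untwist (h : IsCliffordFamily (N + 2) q c γ) (hq0 : q ≠ 0)
    (hκ : pairScalar N q c ≠ 0) (i : Fin N) :
    twist (idem (pairScalar N q c) (γ 0) (γ (Fin.last (N + 1)))) (-q ^ 2) * untwist q c γ i =
      γ (inner i) := by
  rw [untwist, ← mul_assoc, twist_mul_twist ((h.isFermionPair hq0).idem_mul_idem hκ), neg_mul_neg,
    mul_inv_cancel₀ (pow_ne_zero 2 hq0), twist_one, one_mul]

/-- The untwisted inner members of a family for `N + 2` form a family for `N`. -/
lemma IsCliffordFamily.untwist (hq0 : q ≠ 0) (hq2 : q ^ 2 - 1 ≠ 0) (hκ : pairScalar N q c ≠ 0)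
    (h : IsCliffordFamily (N + 2) q c γ) : IsCliffordFamily N q c (untwist q c γ) := by
  have huv := h.isFermionPair hq0
  have hc := h.commute_idem_inner (pairScalar N q c)
  set κ := pairScalar N q c with hκdef
  set u := γ 0 with hu
  set v := γ (Fin.last (N + 1)) with hv
  set e := idem κ u v with hedef
  have he : e * e = e := huv.idem_mul_idem hκ
  have hprod : ∀ i j, FRT.untwist q c γ i * FRT.untwist q c γ j =
      twist e (q ^ 4)⁻¹ * (γ (inner i) * γ (inner j)) := fun i j => by
    refine (twist_mul_mul_twist_mul he _ (hc i) _).trans ?_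
    congr 2
    field_simp
  have hUV : u * v = κ • e := IsFermionPair.left_mul_right hκ
  have hVU : v * u = κ • (1 : A) - κ • e := by rw [huv.right_mul_left, hUV]
  have hP : ∀ j, twist e (q ^ 4)⁻¹ * partialMetric (N + 2) q γ (inner j) =
      ((q ^ 4)⁻¹ * (q ^ 2 + 1) * c ^ 2) • e + partialMetric N q (FRT.untwist q c γ) j := by
    intro j
    rw [partialMetric_inner]
    have := partialMetric_twist_mul q he (-(q ^ 2)⁻¹) (fun i => γ (inner i)) hc j
    rw [show -(q ^ 2)⁻¹ * -(q ^ 2)⁻¹ = (q ^ 4)⁻¹ by field_simp] at this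
    rw [mul_add, ← this, ← hu, ← hv, hUV]
    congr 1
    simp only [twist, mul_smul_comm, add_mul, smul_mul_assoc, he, one_mul]
    rw [hκdef, pairScalar]
    match_scalars
    field_simp
    ring
  refine ⟨fun i => ?_, fun i j hlt hij => ?_, fun i hlt => ?_, fun i hlt => ?_, ?_⟩
  · rw [hprod, h.sq, mul_zero]
  · rw [hprod, hprod, h.anti _ _ (inner_lt_inner.2 hlt)
      (fun h => hij (inner_injective (by rw [h, rev_inner]))), mul_smul_comm]
  · have := congrArg (twist e (q ^ 4)⁻¹ * ·)
      (h.up (inner i) (by rwa [rev_inner, inner_lt_inner]))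
    simp only [mul_add, mul_smul_comm, mul_one, rev_inner, hP, weight_inner] at this
    rw [hprod, hprod, this]
    simp only [twist]
    match_scalars <;> field_simp
    ring
  · have := congrArg (twist e (q ^ 4)⁻¹ * ·)
      (h.down (inner i) (by rwa [rev_inner, inner_lt_inner]))
    simp only [mul_add, mul_smul_comm, mul_one, rev_inner, hP, weight_inner] at this
    rw [hprod, hprod, this]
    simp only [twist]
    match_scalars <;> field_simp
    ring
  · have hm := h.metric
    rw [sum_metric_eq, ← hu, ← hv, hUV, hVU] at hm
    -- The outer terms of the metric lie in the span of 1 and e. Multiplying the inner part by the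
    -- twist q⁻⁴ leaves a scalar.
    have hs : ∑ i : Fin N, weight N q i • (γ (inner i) * γ (inner i.rev)) =
        (c ^ 2 * ((q ^ (2 * (N + 2)) - 1) / (q ^ 2 - 1))) • (1 : A) - (q ^ N)⁻¹ • κ • e -
          q ^ N • (κ • (1 : A) - κ • e) := by
      rw [← hm]; abel
    have ht := congrArg (twist e (q ^ 4)⁻¹ * ·) hs
    simp only [Finset.mul_sum] at ht
    simp only [hprod, ← mul_smul_comm (_ : ℂ) (twist _ _)]
    rw [ht]
    simp only [twist, mul_sub, add_mul, mul_smul_comm, smul_mul_assoc, he, one_mul, mul_one]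
    rw [hκdef, pairScalar]
    match_scalars <;> field_simp <;> ring

end Recursion

/-! ### Matrix units and functoriality -/

section MatrixUnits

variable {A B : Type*} [Ring A] [Algebra ℂ A] [Ring B] [Algebra ℂ B]

/-- Matrix units commuting with the image of `B` extend a homomorphism from `B` to matrices
over `B`. -/
lemma exists_matrixAlgHom {n : Type*} [Fintype n] [DecidableEq n] (h : B →ₐ[ℂ] A)
    (E : n → n → A) (hE : ∀ i j k l, E i j * E k l = if j = k then E i l else 0)
    (h1 : ∑ i, E i i = 1) (hc : ∀ i j b, Commute (E i j) (h b)) :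
    ∃ ψ : Matrix n n B →ₐ[ℂ] A, ∀ M, ψ M = ∑ i, ∑ j, h (M i j) * E i j := by
  let L : Matrix n n B →ₗ[ℂ] A :=
    { toFun := fun M => ∑ i, ∑ j, h (M i j) * E i j
      map_add' := fun M M' => by simp [add_mul, Finset.sum_add_distrib]
      map_smul' := fun a M => by simp [Finset.smul_sum] }
  refine ⟨AlgHom.ofLinearMap L ?_ ?_, fun M => rfl⟩
  · change ∑ i, ∑ j, h ((1 : Matrix n n B) i j) * E i j = 1
    rw [← h1]
    refine Finset.sum_congr rfl fun i _ => ?_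
    rw [Finset.sum_eq_single i] <;> simp +contextual [eq_comm]
  · intro M M'
    change ∑ i, ∑ j, h ((M * M') i j) * E i j =
      (∑ i, ∑ j, h (M i j) * E i j) * ∑ i, ∑ j, h (M' i j) * E i j
    simp only [Finset.sum_mul]
    refine Finset.sum_congr rfl fun i _ => ?_
    have hterm : ∀ j, h (M i j) * E i j * ∑ k, ∑ l, h (M' k l) * E k l =
        ∑ l, h (M i j) * h (M' j l) * E i l := by
      intro j
      rw [Finset.mul_sum, Finset.sum_eq_single j, Finset.mul_sum]
      · refine Finset.sum_congr rfl fun l _ => ?_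
        rw [mul_assoc, ← mul_assoc (E i j), (hc i j _).eq, mul_assoc, hE, if_pos rfl, mul_assoc]
      · intro k _ hk
        rw [Finset.mul_sum]
        refine Finset.sum_eq_zero fun l _ => ?_
        rw [mul_assoc, ← mul_assoc (E i j), (hc i j _).eq, mul_assoc, hE, if_neg hk.symm]
        simp
      · simp
    simp only [hterm]
    rw [Finset.sum_comm]
    simp only [Matrix.mul_apply, map_sum, map_mul, Finset.sum_mul]

/-- The matrix units of a fermion pair. -/
noncomputable def pairUnits (κ : ℂ) (u v : A) : Matrix (Fin 2) (Fin 2) A :=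
  !![idem κ u v, u; κ⁻¹ • v, 1 - idem κ u v]

/-- The factor κ⁻¹ on v normalises the products: κ⁻¹uv = e and κ⁻¹vu = 1 - e. -/
lemma IsFermionPair.pairUnits_mul {κ : ℂ} {u v : A} (h : IsFermionPair κ u v) (hκ : κ ≠ 0)
    (i j k l : Fin 2) : pairUnits κ u v i j * pairUnits κ u v k l =
      if j = k then pairUnits κ u v i l else 0 := by
  have hVU : v * u = κ • (1 - idem κ u v) := by
    rw [h.right_mul_left, IsFermionPair.left_mul_right hκ, smul_sub]
  have hUV : u * v = κ • idem κ u v := IsFermionPair.left_mul_right hκ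
  fin_cases i <;> fin_cases j <;> fin_cases k <;> fin_cases l <;>
    simp [pairUnits, mul_sub, sub_mul, h.idem_mul_idem hκ, h.idem_mul_left hκ, h.idem_mul_right,
      h.left_mul_idem, h.right_mul_idem hκ, h.sq_left, h.sq_right, hVU,
      hUV, smul_smul, hκ]

lemma IsCliffordFamily.map {N : ℕ} {q c : ℂ} {g : Fin N → A} (hg : IsCliffordFamily N q c g)
    (f : A →ₐ[ℂ] B) : IsCliffordFamily N q c fun i => f (g i) := by
  have hP : ∀ j, f (partialMetric N q g j) = partialMetric N q (fun i => f (g i)) j := fun j => by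
    simp [partialMetric, apply_ite f]
  refine ⟨fun i => ?_, fun i j hlt hij => ?_, fun i hlt => ?_, fun i hlt => ?_, ?_⟩
  · simpa using congrArg f (hg.sq i)
  · simpa using congrArg f (hg.anti i j hlt hij)
  · simpa [hP] using congrArg f (hg.up i hlt)
  · simpa [hP] using congrArg f (hg.down i hlt)
  · simpa using congrArg f hg.metric

end MatrixUnits

/-- If an element commutes with the images of the generators, then it commutes with the image of
the FRT-Clifford algebra. -/
lemma commute_of_commute_gen {A : Type*} [Ring A] [Algebra ℂ A] {N : ℕ} {q c : ℂ}
    (h : Clifford N q c →ₐ[ℂ] A) {x : A} (hx : ∀ i, Commute x (h (gen N q c i)))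
    (b : Clifford N q c) : Commute x (h b) := by
  have hb : b ∈ (Subalgebra.centralizer ℂ {x}).comap h := by
    have hle : Algebra.adjoin ℂ (Set.range (gen N q c)) ≤
        (Subalgebra.centralizer ℂ {x}).comap h := by
      refine Algebra.adjoin_le ?_
      rintro _ ⟨i, rfl⟩
      exact Subalgebra.mem_centralizer_iff ℂ |>.2 (by rintro _ rfl; exact (hx i).eq)
    rw [adjoin_gen] at hle
    exact hle trivial
  exact Subalgebra.mem_centralizer_iff ℂ |>.1 hb x rfl

/-- The FRT-Clifford algebra on no generators is simple. -/
lemma isSimpleRing_clifford_zero (q c : ℂ) : IsSimpleRing (Clifford 0 q c) := by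
  obtain ⟨φ, -⟩ := exists_lift (N := 0) (q := q) (c := c) (A := ℂ) (g := fun i => i.elim0)
    (fun i => i.elim0) (by simp)
  have : Nontrivial (Clifford 0 q c) := φ.toRingHom.domain_nontrivial
  refine IsSimpleRing.of_surjective (Algebra.ofId ℂ (Clifford 0 q c)).toRingHom inferInstance ?_
  have h := adjoin_gen 0 q c
  rw [Set.range_eq_empty, Algebra.adjoin_empty] at h
  exact fun x => Algebra.mem_bot.1 (h ▸ trivial : x ∈ (⊥ : Subalgebra ℂ (Clifford 0 q c)))

/-! ### The induction step -/

section Step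

variable {N : ℕ} {q c : ℂ}

/-- A homomorphism to the nonzero ring M₂(`Cl_q(N)`) suffices. The outer pair consists of multiples
of elementary matrices, and the old generators enter as scalar matrices, which commute with it. -/
lemma nontrivial_clifford_add_two (hN : ∀ i : Fin N, i ≠ i.rev)
    (hN2 : ∀ i : Fin (N + 2), i ≠ i.rev) (hq0 : q ≠ 0) (hq : ∀ m : ℕ, 0 < m → q ^ m - 1 ≠ 0)
    (hq2 : q ^ 2 - 1 ≠ 0) (hq4 : q ^ 4 + 1 ≠ 0) (hκ : pairScalar N q c ≠ 0)
    [Nontrivial (Clifford N q c)] : Nontrivial (Clifford (N + 2) q c) := by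
  have hg := (isCliffordFamily_iff hN hq0 hq2 hq4 (fun h => hq _ (by lia)) (gen N q c)).2
    ⟨gen_pplus N q c, gen_metric N q c⟩
  set κ := pairScalar N q c with hκdef
  let u : Matrix (Fin 2) (Fin 2) (Clifford N q c) := Matrix.single 0 1 1
  let v : Matrix (Fin 2) (Fin 2) (Clifford N q c) := κ • Matrix.single 1 0 1
  have huv : IsFermionPair κ u v := by
    refine ⟨by simp [u], by simp [v], ?_⟩
    simp only [u, v, mul_smul_comm, smul_mul_assoc, Matrix.single_mul_single_same, ← smul_add,
      mul_one]
    congr 1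
    ext i j
    fin_cases i <;> fin_cases j <;> simp
  have hd := hg.map (Matrix.scalarAlgHom (Fin 2) ℂ)
  have hu : ∀ i, Commute u (Matrix.scalarAlgHom (Fin 2) ℂ (gen N q c i)) := fun i => by
    ext a b
    fin_cases a <;> fin_cases b <;> simp [u, Matrix.mul_apply]
  have hv : ∀ i, Commute v (Matrix.scalarAlgHom (Fin 2) ℂ (gen N q c i)) := fun i => by
    ext a b
    fin_cases a <;> fin_cases b <;> simp [v, Matrix.mul_apply]
  have hext := hd.extend_twist hq0 hq2 hκ huv hu hv
  obtain ⟨hP, hm⟩ := (isCliffordFamily_iff hN2 hq0 hq2 hq4 (fun _ => hq _ (by lia)) _).1 hext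
  obtain ⟨φ, -⟩ := exists_lift hP hm
  exact φ.toRingHom.domain_nontrivial

lemma isSimpleRing_clifford_add_two (hN : ∀ i : Fin N, i ≠ i.rev)
    (hN2 : ∀ i : Fin (N + 2), i ≠ i.rev) (hq0 : q ≠ 0) (hq : ∀ m : ℕ, 0 < m → q ^ m - 1 ≠ 0)
    (hq2 : q ^ 2 - 1 ≠ 0) (hq4 : q ^ 4 + 1 ≠ 0) (hκ : pairScalar N q c ≠ 0)
    (hs : IsSimpleRing (Clifford N q c)) : IsSimpleRing (Clifford (N + 2) q c) := by
  have := nontrivial_clifford_add_two hN hN2 hq0 hq hq2 hq4 hκ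
  have hγ := (isCliffordFamily_iff hN2 hq0 hq2 hq4 (fun _ => hq _ (by lia))
    (gen (N + 2) q c)).2 ⟨gen_pplus _ q c, gen_metric _ q c⟩
  have huv := hγ.isFermionPair hq0
  obtain ⟨hP, hm⟩ := (isCliffordFamily_iff hN hq0 hq2 hq4 (fun h => hq _ (by lia)) _).1
    (hγ.untwist hq0 hq2 hκ)
  obtain ⟨h, hh⟩ := exists_lift hP hm
  have hu := commute_of_commute_gen h fun i =>
    (hh i).symm ▸ hγ.commute_zero_untwist hq0 hκ i
  have hv := commute_of_commute_gen h fun i =>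
    (hh i).symm ▸ hγ.commute_last_untwist hq0 hκ i
  set κ := pairScalar N q c with hκdef
  set u := gen (N + 2) q c 0 with hudef
  set v := gen (N + 2) q c (Fin.last (N + 1)) with hvdef
  obtain ⟨ψ, hψ⟩ := exists_matrixAlgHom h (pairUnits κ u v) (huv.pairUnits_mul hκ)
    (by simp [pairUnits]) (by
      intro i j b
      have he := commute_idem (κ := κ) (hu b) (hv b)
      fin_cases i <;> fin_cases j
      · exact he
      · exact hu b
      · exact (hv b).smul_left κ⁻¹
      · exact (Commute.one_left (h b)).sub_left he)
  -- Surjectivity: the range contains the matrix units and the image of `h`, hence the twists, and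
  -- so every generator.
  have hunit : ∀ i j, pairUnits κ u v i j ∈ ψ.range := fun i j => by
    refine ⟨Matrix.single i j 1, (hψ _).trans ?_⟩
    rw [Finset.sum_eq_single i, Finset.sum_eq_single j] <;>
      simp +contextual [Matrix.single_apply, eq_comm]
  have hscalar : ∀ b, h b ∈ ψ.range := fun b => by
    refine ⟨Matrix.diagonal fun _ => b, (hψ _).trans ?_⟩
    simp [Fin.sum_univ_two, pairUnits, ← mul_add]
  have htwist : ∀ a, twist (idem κ u v) a ∈ ψ.range := fun a =>
    add_mem (one_mem _) (Subalgebra.smul_mem _ (hunit 0 0) _)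
  have hgen : ∀ i, gen (N + 2) q c i ∈ ψ.range := by
    refine outer_inner_cases (hunit 0 1) ?_ fun i => ?_
    · have := Subalgebra.smul_mem _ (hunit 1 0) κ
      simpa [pairUnits, smul_smul, hκ] using this
    · rw [← hγ.twist_mul_untwist hq0 hκ i, ← hh i]
      exact mul_mem (htwist _) (hscalar _)
  have hle : Algebra.adjoin ℂ (Set.range (gen (N + 2) q c)) ≤ ψ.range :=
    Algebra.adjoin_le (by rintro _ ⟨i, rfl⟩; exact hgen i)
  rw [adjoin_gen, top_le_iff, AlgHom.range_eq_top] at hle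
  exact IsSimpleRing.of_surjective ψ.toRingHom inferInstance hle

end Step

end FRT

theorem mainTheorem5 (n : ℕ) (hn : 3 ≤ 2 * n) (q c : ℂ) (hq0 : q ≠ 0)
    (hq : ∀ m : ℕ, 0 < m → q ^ m ≠ 1)
    (hc : ∃ r : ℝ, r ≠ 0 ∧ c ^ 2 = (r : ℂ)) :
    IsSimpleRing (FRT.Clifford (2 * n) q c) := by
  clear hn
  have hq' : ∀ m : ℕ, 0 < m → q ^ m - 1 ≠ 0 := fun m hm => sub_ne_zero.2 (hq m hm)
  have hc2 : c ^ 2 ≠ 0 := by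
    obtain ⟨r, hr, h⟩ := hc
    rw [h]
    exact_mod_cast hr
  have hq4 : q ^ 4 + 1 ≠ 0 := fun h => hq 8 (by norm_num) (by linear_combination (q ^ 4 - 1) * h)
  have hq2 : q ^ 2 + 1 ≠ 0 := fun h => hq 4 (by norm_num) (by linear_combination (q ^ 2 - 1) * h)
  have hrev : ∀ (m : ℕ) (i : Fin (2 * m)), i ≠ i.rev := fun m i h => by
    have := congrArg Fin.val h
    rw [Fin.val_rev] at this
    lia
  -- The induction starts at n = 0, where the algebra is ℂ.
  induction n with
  | zero => exact FRT.isSimpleRing_clifford_zero q c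
  | succ n ih =>
    exact FRT.isSimpleRing_clifford_add_two (hrev n) (hrev (n + 1)) hq0 hq' (hq' 2 two_pos) hq4
      (mul_ne_zero (mul_ne_zero hq2 hc2) (pow_ne_zero _ hq0)) ih
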